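/- Let $n,d\ge 1$ and let $f\in\mathbb R[x_1,\dots,x_n]$ be a square-free homogeneous polynomial of degree $d$ that is hyperbolic with respect to $e\in\mathbb R^n$, that is, $f(e)\ne 0$ and for every $a\in\mathbb R^n$ all complex roots of the univariate polynomial $f(te+a)$ in $t$ are real. Assume $f(e)>0$. Let $C(f,e)$ be the connected component of $e$ in $\mathbb R^n\setminus\{x : f(x)=0\}$. For $a\in\mathbb R^n$ put $$D_af=\sum_{i=1}^n a_i\frac{\partial f}{\partial x_i},\qquad \Delta_{e,a}f=D_ef\cdot D_af-f\cdot D_eD_af .$$ A real univariate polynomial $q$ interlaces a real univariate polynomial $p$ if both have only real zeros, $\deg q=\deg p-1$, and the roots $\alpha_1\le\dots\le\alpha_m$ of $p$ and $\beta_1\le\dots\le\beta_{m-1}$ of $q$, counted with multiplicity, satisfy $\alpha_i\le\beta_i\le\alpha_{i+1}$ for all $i=1,\dots,m-1$. Let $\mathrm{Int}(f,e)$ be the set consisting of the zero polynomial and of all homogeneous $g\in\mathbb R[x_1,\dots,x_n]$ of degree $d-1$ such that $g(e)>0$ and $g(te+a)$ interlaces $f(te+a)$ for every $a\in\mathbb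 R^n$. Then the intersection of $\mathrm{Int}(f,e)$ with the linear span of $\partial f/\partial x_1,\dots,\partial f/\partial x_n$ is the image of $\overline{C(f,e)}$ under the linear map $a\mapsto D_af$, and $$\overline{C(f,e)}=\{a\in\mathbb R^n : D_af\in\mathrm{Int}(f,e)\}.$$ Furthermore, $$\overline{C(f,e)}=\{a\in\mathbb R^n : \Delta_{e,a}f\ge 0\text{ on }\mathbb R^n\},$$ which is a linear section of the cone of nonnegative forms of degree $2d-2$ in the following sense: the map $a\mapsto\Delta_{e,a}f$ is linear, each $\Delta_{e,a}f$ is homogeneous of degree $2d-2$ (or zero), and the image of $\overline{C(f,e)}$ under this map is the intersection of the linear space $\{\Delta_{e,a}f : a\in\mathbb R^n\}$ with the cone of nonnegative forms of degree $2d-2$ in $x_1,\dots,x_n$. -/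

import Mathlib

namespace Hyperbolicity

/-- The univariate polynomial `f(t e + a)` in the variable `t`. -/
noncomputable def lineRestrict {n : ℕ} (f : MvPolynomial (Fin n) ℝ) (e a : Fin n → ℝ) :
    Polynomial ℝ :=
  MvPolynomial.aeval (fun i => Polynomial.C (e i) * Polynomial.X + Polynomial.C (a i)) f

/-- `f` is hyperbolic with respect to `e`: it is homogeneous, `f(e) ≠ 0`, and for every real `a`
all complex roots of `f(t e + a)` are real. -/
structure IsHyperbolic {n : ℕ} (f : MvPolynomial (Fin n) ℝ) (e : Fin n → ℝ) : Prop where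
  homogeneous : ∃ d : ℕ, f.IsHomogeneous d
  eval_ne_zero : MvPolynomial.eval e f ≠ 0
  real_roots : ∀ (a : Fin n → ℝ) (z : ℂ), Polynomial.aeval z (lineRestrict f e a) = 0 → z.im = 0

/-- The (open) hyperbolicity cone `C(f, e)`: the connected component of `e` in the complement of
the real zero set of `f`. -/
def hyperbolicityCone {n : ℕ} (f : MvPolynomial (Fin n) ℝ) (e : Fin n → ℝ) : Set (Fin n → ℝ) :=
  connectedComponentIn {x | MvPolynomial.eval x f ≠ 0} e

/-- The univariate polynomial `q` interlaces `p`: both have only real zeros (so that they are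
products of linear factors), `deg q = deg p - 1`, and the ordered lists of roots `α` of `p` and
`β` of `q`, counted with multiplicity, satisfy `α i ≤ β i ≤ α (i + 1)`. -/
def Interlaces (q p : Polynomial ℝ) : Prop :=
  ∃ (m : ℕ) (α : Fin (m + 1) → ℝ) (β : Fin m → ℝ) (c c' : ℝ),
    c ≠ 0 ∧ c' ≠ 0 ∧ Monotone α ∧ Monotone β ∧
    p = Polynomial.C c * ∏ i, (Polynomial.X - Polynomial.C (α i)) ∧
    q = Polynomial.C c' * ∏ i, (Polynomial.X - Polynomial.C (β i)) ∧
    ∀ i : Fin m, α i.castSucc ≤ β i ∧ β i ≤ α i.succ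

/-- The form `g`, of degree `deg f - 1`, interlaces `f` with respect to `e`. -/
def InterlacesWrt {n : ℕ} (g f : MvPolynomial (Fin n) ℝ) (e : Fin n → ℝ) : Prop :=
  g.IsHomogeneous (f.totalDegree - 1) ∧
    ∀ a : Fin n → ℝ, Interlaces (lineRestrict g e a) (lineRestrict f e a)

/-- The cone `Int(f, e)` of interlacers of `f` that are positive at `e`, together with the zero
polynomial (the apex of this closed convex cone). -/
def interlacerCone {n : ℕ} (f : MvPolynomial (Fin n) ℝ) (e : Fin n → ℝ) :
    Set (MvPolynomial (Fin n) ℝ) :=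
  {g | g = 0 ∨ (InterlacesWrt g f e ∧ 0 < MvPolynomial.eval e g)}

/-- The directional derivative `D_a f = ∑ i, a i * ∂f/∂x_i`. -/
noncomputable def dirDeriv {n : ℕ} (a : Fin n → ℝ) (f : MvPolynomial (Fin n) ℝ) :
    MvPolynomial (Fin n) ℝ :=
  ∑ i, MvPolynomial.C (a i) * MvPolynomial.pderiv i f

/-- `Δ_{e,a} f = D_e f * D_a f - f * D_e (D_a f)`. -/
noncomputable def delta {n : ℕ} (f : MvPolynomial (Fin n) ℝ) (e a : Fin n → ℝ) :
    MvPolynomial (Fin n) ℝ :=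
  dirDeriv e f * dirDeriv a f - f * dirDeriv e (dirDeriv a f)

/-- The cone of nonnegative real forms of degree `k` in `n` variables. -/
def nonnegForms (n k : ℕ) : Set (MvPolynomial (Fin n) ℝ) :=
  {p | p.IsHomogeneous k ∧ ∀ x : Fin n → ℝ, 0 ≤ MvPolynomial.eval x p}

end Hyperbolicity

/-! Write F(t) = f(te + x) and G(t) = D_a f(te + x). On this line Δ_{e,a} f is the Wronskian F'G -
FG', so both descriptions of the closed cone are statements about the pair (G, F).

The cone C(f, e) consists of the a with f(te + a) ≠ 0 for all t ≥ 0
(`hyperbolicityCone_eq_rootCone`); for its closure, t > 0 suffices. If a lies in the open cone,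
Gårding's argument shows that f(x + iαe + ta) ≠ 0 for α > 0 and Im t ≥ 0
(`aeval_ne_zero_of_mem_rootCone`). The logarithmic derivative in t at 0 then gives Im(G/F) ≤ 0 on
the upper half-plane, and this passes to limits in a. Such a pair has nonnegative Wronskian, hence Δ
≥ 0, and either G = 0 or G interlaces F (`IsAntiHerglotz.eq_zero_or_interlaces`).

Conversely, take x = a. Euler's identity gives G = dF - tF', and a positive zero of F is
incompatible both with a nonnegative Wronskian (`exists_wronskian_euler_neg`) and with interlacing
under positive leading coefficients (`Interlaces.eval_ne_zero`). The statements about images follow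
formally. -/

namespace Hyperbolicity

open Polynomial Topology Filter

/-! ### Restriction of forms to lines, and directional derivatives -/

section LinePoly

variable {n d : ℕ} {A : Type*} [CommRing A] [Algebra ℝ A]

/-- The univariate polynomial `f(t u + v)` in the variable `t`, with coefficients in `A`. -/
noncomputable def linePoly (f : MvPolynomial (Fin n) ℝ) (u v : Fin n → A) : A[X] :=
  MvPolynomial.aeval (fun i => C (u i) * X + C (v i)) f

theorem lineRestrict_eq_linePoly (f : MvPolynomial (Fin n) ℝ) (e a : Fin n → ℝ) :
    lineRestrict f e a = linePoly f e a := rfl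

theorem eval_linePoly (f : MvPolynomial (Fin n) ℝ) (u v : Fin n → A) (z : A) :
    (linePoly f u v).eval z = MvPolynomial.aeval (z • u + v) f := by
  unfold linePoly
  induction f using MvPolynomial.induction_on with
  | C r => simp [Polynomial.algebraMap_apply]
  | add p q hp hq => simp [hp, hq]
  | mul_X p i hp => simp [hp, mul_comm z]

theorem aeval_lineRestrict (f : MvPolynomial (Fin n) ℝ) (e a : Fin n → ℝ) (z : A) :
    aeval z (lineRestrict f e a) =
      MvPolynomial.aeval (fun i => z * algebraMap ℝ A (e i) + algebraMap ℝ A (a i)) f := by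
  unfold lineRestrict
  induction f using MvPolynomial.induction_on with
  | C r => simp
  | add p q hp hq => simp [hp, hq]
  | mul_X p i hp => simp [hp, mul_comm z]

theorem eval_lineRestrict (f : MvPolynomial (Fin n) ℝ) (e a : Fin n → ℝ) (t : ℝ) :
    (lineRestrict f e a).eval t = MvPolynomial.eval (t • e + a) f := by
  rw [lineRestrict_eq_linePoly, eval_linePoly, MvPolynomial.aeval_eq_eval]

theorem aeval_algebraMap_comp (f : MvPolynomial (Fin n) ℝ) (x : Fin n → ℝ) :
    MvPolynomial.aeval (fun i => algebraMap ℝ A (x i)) f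
      = algebraMap ℝ A (MvPolynomial.eval x f) := by
  induction f using MvPolynomial.induction_on with
  | C r => simp
  | add p q hp hq => simp [hp, hq]
  | mul_X p i hp => simp [hp]

theorem dirDeriv_mul (a : Fin n → ℝ) (p q : MvPolynomial (Fin n) ℝ) :
    dirDeriv a (p * q) = dirDeriv a p * q + p * dirDeriv a q := by
  simp only [dirDeriv, Derivation.leibniz, smul_eq_mul, Finset.sum_mul, Finset.mul_sum,
    ← Finset.sum_add_distrib]
  exact Finset.sum_congr rfl fun i _ => by ring

theorem dirDeriv_X (a : Fin n → ℝ) (i : Fin n) :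
    dirDeriv a (MvPolynomial.X i) = MvPolynomial.C (a i) := by
  simp [dirDeriv, MvPolynomial.pderiv_X, Pi.single_apply]

/-- `D_a f`, as a linear map in the direction `a`. -/
noncomputable def dirDerivLinear (f : MvPolynomial (Fin n) ℝ) :
    (Fin n → ℝ) →ₗ[ℝ] MvPolynomial (Fin n) ℝ where
  toFun a := dirDeriv a f
  map_add' a b := by simp [dirDeriv, add_mul, Finset.sum_add_distrib]
  map_smul' c a := by simp [dirDeriv, Finset.smul_sum, MvPolynomial.smul_eq_C_mul, mul_assoc]

theorem dirDeriv_add (a : Fin n → ℝ) (p q : MvPolynomial (Fin n) ℝ) :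
    dirDeriv a (p + q) = dirDeriv a p + dirDeriv a q := by
  simp [dirDeriv, mul_add, Finset.sum_add_distrib]

theorem dirDeriv_C (a : Fin n → ℝ) (r : ℝ) : dirDeriv a (MvPolynomial.C r) = 0 := by
  simp [dirDeriv]

theorem derivative_linePoly (f : MvPolynomial (Fin n) ℝ) (a : Fin n → ℝ) (v : Fin n → A) :
    derivative (linePoly f (fun i => algebraMap ℝ A (a i)) v) =
      linePoly (dirDeriv a f) (fun i => algebraMap ℝ A (a i)) v := by
  unfold linePoly
  induction f using MvPolynomial.induction_on with
  | C r => simp [dirDeriv_C, Polynomial.algebraMap_apply]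
  | add p q hp hq => simp [hp, hq, dirDeriv_add]
  | mul_X p i hp =>
    simp [hp, dirDeriv_mul, dirDeriv_X, Polynomial.algebraMap_apply]

theorem derivative_lineRestrict (f : MvPolynomial (Fin n) ℝ) (e a : Fin n → ℝ) :
    derivative (lineRestrict f e a) = lineRestrict (dirDeriv e f) e a :=
  derivative_linePoly f e a

theorem isHomogeneous_dirDeriv {f : MvPolynomial (Fin n) ℝ} (hf : f.IsHomogeneous d)
    (a : Fin n → ℝ) : (dirDeriv a f).IsHomogeneous (d - 1) := by
  refine MvPolynomial.IsHomogeneous.sum _ _ _ fun i _ => ?_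
  simpa using (MvPolynomial.isHomogeneous_C (Fin n) (a i)).mul (hf.pderiv (i := i))

theorem sum_eq_of_mem_support {f : MvPolynomial (Fin n) ℝ} (hf : f.IsHomogeneous d)
    {s : Fin n →₀ ℕ} (hs : s ∈ f.support) : ∑ i, s i = d := by
  rw [← hf (MvPolynomial.mem_support_iff.mp hs), Finsupp.weight_apply, Finsupp.sum_fintype] <;>
    simp

theorem aeval_smul_of_isHomogeneous {f : MvPolynomial (Fin n) ℝ} (hf : f.IsHomogeneous d)
    (c : A) (v : Fin n → A) :
    MvPolynomial.aeval (c • v) f = c ^ d * MvPolynomial.aeval v f := by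
  rw [MvPolynomial.aeval_def, MvPolynomial.eval₂_eq', MvPolynomial.aeval_def,
    MvPolynomial.eval₂_eq', Finset.mul_sum]
  refine Finset.sum_congr rfl fun s hs => ?_
  have h := sum_eq_of_mem_support hf hs
  simp only [Pi.smul_apply, smul_eq_mul, mul_pow, Finset.prod_mul_distrib,
    Finset.prod_pow_eq_pow_sum, h]
  ring

theorem eval_smul_of_isHomogeneous {f : MvPolynomial (Fin n) ℝ} (hf : f.IsHomogeneous d)
    (c : ℝ) (v : Fin n → ℝ) :
    MvPolynomial.eval (c • v) f = c ^ d * MvPolynomial.eval v f := by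
  simpa [MvPolynomial.aeval_eq_eval] using aeval_smul_of_isHomogeneous hf c v

theorem natDegree_prod_linear_pow_le {B : Type*} [CommRing B] (u v : Fin n → B)
    (k : Fin n → ℕ) (S : Finset (Fin n)) :
    (∏ i ∈ S, (C (u i) * X + C (v i)) ^ k i).natDegree ≤ ∑ i ∈ S, k i := by
  refine (natDegree_prod_le _ _).trans (Finset.sum_le_sum fun i _ => ?_)
  simpa using natDegree_pow_le_of_le (k i) (natDegree_linear_le (a := u i) (b := v i))

theorem coeff_prod_linear_pow {B : Type*} [CommRing B] (u v : Fin n → B)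
    (k : Fin n → ℕ) (S : Finset (Fin n)) :
    (∏ i ∈ S, (C (u i) * X + C (v i)) ^ k i).coeff (∑ i ∈ S, k i) = ∏ i ∈ S, u i ^ k i := by
  classical
  induction S using Finset.induction_on with
  | empty => simp
  | insert i S hi ih =>
    rw [Finset.prod_insert hi, Finset.sum_insert hi, Finset.prod_insert hi,
      coeff_mul_add_eq_of_natDegree_le
        (by simpa using natDegree_pow_le_of_le (k i) (natDegree_linear_le (a := u i) (b := v i)))
        (natDegree_prod_linear_pow_le u v k S), ih]
    congr 1
    have := coeff_pow_of_natDegree_le (m := k i) (natDegree_linear_le (a := u i) (b := v i))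
    simpa using this

theorem linePoly_eq_sum (f : MvPolynomial (Fin n) ℝ) (u v : Fin n → A) :
    linePoly f u v = ∑ s ∈ f.support,
      C (algebraMap ℝ A (f.coeff s)) * ∏ i, (C (u i) * X + C (v i)) ^ s i := by
  rw [linePoly, MvPolynomial.aeval_def, MvPolynomial.eval₂_eq']
  rfl

theorem natDegree_linePoly_le {f : MvPolynomial (Fin n) ℝ} (hf : f.IsHomogeneous d)
    (u v : Fin n → A) : (linePoly f u v).natDegree ≤ d := by
  rw [linePoly_eq_sum]
  refine natDegree_sum_le_of_forall_le _ _ fun s hs => ?_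
  refine (natDegree_C_mul_le _ _).trans ?_
  rw [← sum_eq_of_mem_support hf hs]
  exact natDegree_prod_linear_pow_le u v _ _

theorem coeff_linePoly {f : MvPolynomial (Fin n) ℝ} (hf : f.IsHomogeneous d)
    (u v : Fin n → A) : (linePoly f u v).coeff d = MvPolynomial.aeval u f := by
  rw [linePoly_eq_sum, MvPolynomial.aeval_def, MvPolynomial.eval₂_eq', finsetSum_coeff]
  refine Finset.sum_congr rfl fun s hs => ?_
  rw [coeff_C_mul, ← sum_eq_of_mem_support hf hs, coeff_prod_linear_pow]

theorem natDegree_linePoly {f : MvPolynomial (Fin n) ℝ} (hf : f.IsHomogeneous d)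
    {u : Fin n → A} (hu : MvPolynomial.aeval u f ≠ 0) (v : Fin n → A) :
    (linePoly f u v).natDegree = d :=
  natDegree_eq_of_le_of_coeff_ne_zero (natDegree_linePoly_le hf u v)
    (by rwa [coeff_linePoly hf])

theorem leadingCoeff_linePoly {f : MvPolynomial (Fin n) ℝ} (hf : f.IsHomogeneous d)
    {u : Fin n → A} (hu : MvPolynomial.aeval u f ≠ 0) (v : Fin n → A) :
    (linePoly f u v).leadingCoeff = MvPolynomial.aeval u f := by
  rw [leadingCoeff, natDegree_linePoly hf hu, coeff_linePoly hf]

theorem euler_dirDeriv {f : MvPolynomial (Fin n) ℝ} (hf : f.IsHomogeneous d) (x : Fin n → ℝ) :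
    MvPolynomial.eval x (dirDeriv x f) = d * MvPolynomial.eval x f := by
  have h := congrArg (MvPolynomial.eval x) hf.sum_X_mul_pderiv
  simpa [dirDeriv] using h

end LinePoly

/-! ### The hyperbolicity cone and its closure in terms of real roots -/

variable {n d : ℕ} {f : MvPolynomial (Fin n) ℝ} {e : Fin n → ℝ}

theorem continuous_eval_mvPolynomial (f : MvPolynomial (Fin n) ℝ) :
    Continuous fun x : Fin n → ℝ => MvPolynomial.eval x f :=
  MvPolynomial.continuous_eval f

theorem continuous_aeval_complex (f : MvPolynomial (Fin n) ℝ) :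
    Continuous fun x : Fin n → ℂ => MvPolynomial.aeval x f := by
  simp only [MvPolynomial.aeval_def, MvPolynomial.eval₂_eq']
  fun_prop

/-- Polynomials all of whose complex roots are real split over the reals. -/
theorem splits_of_forall_im_eq_zero {F : ℝ[X]}
    (h : ∀ z : ℂ, aeval z F = 0 → z.im = 0) : F.Splits := by
  refine Splits.of_splits_map (algebraMap ℝ ℂ) (IsAlgClosed.splits _) fun z hz => ?_
  have hz0 : aeval z F = 0 := by
    have := (mem_roots'.1 hz).2
    rwa [IsRoot, eval_map_algebraMap] at this
  exact ⟨z.re, Complex.ext rfl (by simp [h z hz0])⟩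

theorem IsHyperbolic.splits (hf : IsHyperbolic f e) (a : Fin n → ℝ) :
    (lineRestrict f e a).Splits :=
  splits_of_forall_im_eq_zero (hf.real_roots a)

theorem natDegree_lineRestrict (hd : f.IsHomogeneous d) (he : MvPolynomial.eval e f ≠ 0)
    (a : Fin n → ℝ) : (lineRestrict f e a).natDegree = d :=
  natDegree_linePoly hd (by rwa [MvPolynomial.aeval_eq_eval]) a

theorem leadingCoeff_lineRestrict (hd : f.IsHomogeneous d) (he : MvPolynomial.eval e f ≠ 0)
    (a : Fin n → ℝ) : (lineRestrict f e a).leadingCoeff = MvPolynomial.eval e f := by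
  rw [lineRestrict_eq_linePoly, leadingCoeff_linePoly hd (by rwa [MvPolynomial.aeval_eq_eval]),
    MvPolynomial.aeval_eq_eval]

/-- The points `a` all of whose eigenvalues, the zeros of `f(t e - a)`, are positive. -/
def rootCone (f : MvPolynomial (Fin n) ℝ) (e : Fin n → ℝ) : Set (Fin n → ℝ) :=
  {a | ∀ t : ℝ, 0 ≤ t → MvPolynomial.eval (t • e + a) f ≠ 0}

/-- Compares F(t) = lc · ∏ (t - x) factor by factor. The choice g x = 0 - x yields the value at 0,
and the constant g = t yields lc · t ^ d; both bounds are non-strict and so survive passage to the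
closure. -/
theorem prod_le_prod_of_roots_le {F : ℝ[X]} (hF : F.Splits) (hl : 0 ≤ F.leadingCoeff) {t : ℝ}
    (g : ℝ → ℝ) (hg : ∀ x ∈ F.roots, 0 ≤ g x ∧ g x ≤ t - x) :
    F.leadingCoeff * (F.roots.map g).prod ≤ F.eval t := by
  rw [hF.eval_eq_prod_roots]
  exact mul_le_mul_of_nonneg_left
    (Multiset.prod_map_le_prod_map₀ _ _ (fun x hx => (hg x hx).1) fun x hx => (hg x hx).2) hl

theorem lt_zero_of_mem_roots {a : Fin n → ℝ} (ha : a ∈ rootCone f e) {x : ℝ}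
    (hx : x ∈ (lineRestrict f e a).roots) : x < 0 := by
  by_contra! h
  have := (mem_roots'.1 hx).2
  rw [IsRoot, eval_lineRestrict] at this
  exact ha x h this

theorem eval_le_eval_of_mem_rootCone (hd : f.IsHomogeneous d) (hf : IsHyperbolic f e)
    (hpos : 0 < MvPolynomial.eval e f) {a : Fin n → ℝ} (ha : a ∈ rootCone f e) {t : ℝ}
    (ht : 0 ≤ t) : 0 ≤ MvPolynomial.eval a f ∧
      MvPolynomial.eval a f ≤ MvPolynomial.eval (t • e + a) f := by
  have hl := leadingCoeff_lineRestrict hd hf.eval_ne_zero a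
  have h0 : MvPolynomial.eval a f =
      MvPolynomial.eval e f * ((lineRestrict f e a).roots.map (0 - ·)).prod := by
    rw [← hl, ← (hf.splits a).eval_eq_prod_roots, eval_lineRestrict, zero_smul, zero_add]
  constructor
  · rw [h0]
    refine mul_nonneg hpos.le (Multiset.prod_nonneg fun y hy => ?_)
    obtain ⟨x, hx, rfl⟩ := Multiset.mem_map.1 hy
    linarith [lt_zero_of_mem_roots ha hx]
  · rw [h0, ← eval_lineRestrict, ← hl]
    refine prod_le_prod_of_roots_le (hf.splits a) (hl ▸ hpos.le) _ fun x hx => ?_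
    have := lt_zero_of_mem_roots ha hx
    constructor <;> linarith

theorem pow_le_eval_of_mem_rootCone (hd : f.IsHomogeneous d) (hf : IsHyperbolic f e)
    (hpos : 0 < MvPolynomial.eval e f) {a : Fin n → ℝ} (ha : a ∈ rootCone f e) {t : ℝ}
    (ht : 0 ≤ t) :
    MvPolynomial.eval e f * t ^ d ≤ MvPolynomial.eval (t • e + a) f := by
  have hl := leadingCoeff_lineRestrict hd hf.eval_ne_zero a
  have := prod_le_prod_of_roots_le (t := t) (hf.splits a) (hl ▸ hpos.le) (fun _ => t) fun x hx => by
    have := lt_zero_of_mem_roots ha hx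
    constructor <;> linarith
  rwa [hl, Multiset.map_const', Multiset.prod_replicate, ← (hf.splits a).natDegree_eq_card_roots,
    natDegree_lineRestrict hd hf.eval_ne_zero, eval_lineRestrict] at this

/-- A condition `P x y ≠ 0` for all `y` in a compact set is open in `x`. -/
theorem isOpen_forall_ne_zero {X Y Z : Type*} [TopologicalSpace X] [TopologicalSpace Y]
    [TopologicalSpace Z] [Zero Z] [T1Space Z] {K : Set Y} (hK : IsCompact K) {P : X × Y → Z}
    (hP : Continuous P) : IsOpen {x | ∀ y ∈ K, P (x, y) ≠ 0} := by
  rw [isOpen_iff_mem_nhds]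
  intro x hx
  refine hK.eventually_forall_of_forall_eventually fun y hy => ?_
  exact hP.continuousAt.eventually_ne (hx y hy)

/-- By homogeneity the ray te + a, t ≥ 0, rescales into the segment from a to e. Its compact
parameter set makes the cone open, and the segment itself connects a to e. -/
theorem mem_rootCone_iff_segment (hd : f.IsHomogeneous d) (he : MvPolynomial.eval e f ≠ 0)
    {a : Fin n → ℝ} : a ∈ rootCone f e ↔
      ∀ s ∈ Set.Icc (0 : ℝ) 1, MvPolynomial.eval (s • e + (1 - s) • a) f ≠ 0 := by
  constructor
  · intro ha s hs
    rcases hs.2.eq_or_lt with rfl | h1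
    · simpa using he
    have h1' : 0 < 1 - s := by linarith
    have : s • e + (1 - s) • a = (1 - s) • ((s / (1 - s)) • e + a) := by
      rw [smul_add, smul_smul, mul_div_cancel₀ _ h1'.ne']
    rw [this, eval_smul_of_isHomogeneous hd]
    exact mul_ne_zero (pow_ne_zero _ h1'.ne') (ha _ (div_nonneg hs.1 h1'.le))
  · intro h t ht h0
    have h1 : 0 < 1 + t := by linarith
    refine h (t / (1 + t)) ⟨by positivity, (div_le_one h1).2 (by linarith)⟩ ?_
    have : (t / (1 + t)) • e + (1 - t / (1 + t)) • a = (1 + t)⁻¹ • (t • e + a) := by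
      rw [smul_add, smul_smul]
      congr 2 <;> field_simp
      ring
    rw [this, eval_smul_of_isHomogeneous hd, h0, mul_zero]

theorem isOpen_rootCone (hd : f.IsHomogeneous d) (he : MvPolynomial.eval e f ≠ 0) :
    IsOpen (rootCone f e) := by
  have : rootCone f e = {a | ∀ s ∈ Set.Icc (0 : ℝ) 1,
      MvPolynomial.eval (s • e + (1 - s) • a) f ≠ 0} :=
    Set.ext fun a => mem_rootCone_iff_segment hd he
  rw [this]
  exact isOpen_forall_ne_zero isCompact_Icc
    (P := fun p : (Fin n → ℝ) × ℝ => MvPolynomial.eval (p.2 • e + (1 - p.2) • p.1) f)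
    ((continuous_eval_mvPolynomial f).comp (by fun_prop))

theorem self_mem_rootCone (hd : f.IsHomogeneous d) (he : MvPolynomial.eval e f ≠ 0) :
    e ∈ rootCone f e := by
  rw [mem_rootCone_iff_segment hd he]
  intro s _
  rwa [← add_smul, add_sub_cancel, one_smul]

theorem hyperbolicityCone_eq_rootCone (hd : f.IsHomogeneous d) (hf : IsHyperbolic f e)
    (hpos : 0 < MvPolynomial.eval e f) : hyperbolicityCone f e = rootCone f e := by
  have he := hf.eval_ne_zero
  apply Set.Subset.antisymm
  · refine isPreconnected_connectedComponentIn.subset_of_closure_inter_subset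
      (isOpen_rootCone hd he)
      ⟨e, mem_connectedComponentIn he, self_mem_rootCone hd he⟩ ?_
    -- A limit point with f(a) ≠ 0 inherits 0 ≤ f(a) ≤ f(te + a), hence f(te + a) > 0. So the root
    -- cone is relatively closed where f ≠ 0.
    rintro a ⟨ha, haC⟩
    have ha0 : MvPolynomial.eval a f ≠ 0 := connectedComponentIn_subset _ _ haC
    have hc := continuous_eval_mvPolynomial f
    set S := {b : Fin n → ℝ | ∀ t : ℝ, 0 ≤ t → 0 ≤ MvPolynomial.eval b f ∧
      MvPolynomial.eval b f ≤ MvPolynomial.eval (t • e + b) f} with hS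
    have hcl : IsClosed S := by
      simp only [hS, Set.ofPred_forall]
      refine isClosed_iInter fun t => isClosed_iInter fun _ => ?_
      exact (isClosed_le continuous_const hc).inter
        (isClosed_le hc (hc.comp (by fun_prop)))
    have hsub : rootCone f e ⊆ S :=
      fun b hb t ht => eval_le_eval_of_mem_rootCone hd hf hpos hb ht
    intro t ht
    obtain ⟨h1, h2⟩ := closure_minimal hsub hcl ha t ht
    exact ((lt_of_le_of_ne h1 ha0.symm).trans_le h2).ne'
  · intro a ha
    refine IsPreconnected.subset_connectedComponentIn (convex_segment e a).isPreconnected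
      (left_mem_segment ℝ e a) ?_ (right_mem_segment ℝ e a)
    rintro _ ⟨s, r, hs, hr, hsr, rfl⟩
    obtain rfl : r = 1 - s := by linarith
    exact (mem_rootCone_iff_segment hd he).1 ha s ⟨hs, by linarith⟩

theorem add_smul_mem_rootCone {a : Fin n → ℝ}
    (ha : ∀ t : ℝ, 0 < t → MvPolynomial.eval (t • e + a) f ≠ 0) {ε : ℝ} (hε : 0 < ε) :
    ε • e + a ∈ rootCone f e := by
  intro t ht
  rw [← add_assoc, ← add_smul]
  exact ha _ (by linarith)

theorem mem_closure_hyperbolicityCone_iff (hd : f.IsHomogeneous d) (hf : IsHyperbolic f e)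
    (hpos : 0 < MvPolynomial.eval e f) {a : Fin n → ℝ} :
    a ∈ closure (hyperbolicityCone f e) ↔
      ∀ t : ℝ, 0 < t → MvPolynomial.eval (t • e + a) f ≠ 0 := by
  rw [hyperbolicityCone_eq_rootCone hd hf hpos]
  constructor
  · intro ha t ht
    have hc := continuous_eval_mvPolynomial f
    have hcl : IsClosed {b : Fin n → ℝ |
        MvPolynomial.eval e f * t ^ d ≤ MvPolynomial.eval (t • e + b) f} :=
      isClosed_le continuous_const (hc.comp (by fun_prop))
    have := closure_minimal (fun b hb => pow_le_eval_of_mem_rootCone hd hf hpos hb ht.le) hcl ha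
    exact ((by positivity : 0 < MvPolynomial.eval e f * t ^ d).trans_le this).ne'
  · intro ha
    have hlim : Tendsto (fun ε : ℝ => ε • e + a) (𝓝[>] 0) (𝓝 a) := by
      have : Continuous fun ε : ℝ => ε • e + a := by fun_prop
      simpa using (this.tendsto 0).mono_left nhdsWithin_le_nhds
    exact mem_closure_of_tendsto hlim
      (eventually_mem_nhdsWithin.mono fun ε hε => add_smul_mem_rootCone ha hε)

/-! ### Gårding's theorem as a stability statement -/

/-- The real vector `x`, viewed as a complex vector. -/
noncomputable def toComplex (x : Fin n → ℝ) : Fin n → ℂ := fun i => algebraMap ℝ ℂ (x i)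

theorem aeval_toComplex (f : MvPolynomial (Fin n) ℝ) (x : Fin n → ℝ) :
    MvPolynomial.aeval (toComplex x) f = (MvPolynomial.eval x f : ℂ) :=
  aeval_algebraMap_comp f x

theorem continuous_toComplex : Continuous (toComplex (n := n)) :=
  continuous_pi fun i => Complex.continuous_ofReal.comp (continuous_apply i)

theorem aeval_lineRestrict_complex (f : MvPolynomial (Fin n) ℝ) (e a : Fin n → ℝ) (z : ℂ) :
    aeval z (lineRestrict f e a) = MvPolynomial.aeval (z • toComplex e + toComplex a) f :=
  aeval_lineRestrict f e a z

/-- For hyperbolic `f`, the value at `z e + x` with `x` real is nonzero for nonreal `z`. -/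
theorem IsHyperbolic.aeval_ne_zero (hf : IsHyperbolic f e) (x : Fin n → ℝ) {z : ℂ}
    (hz : z.im ≠ 0) : MvPolynomial.aeval (z • toComplex e + toComplex x) f ≠ 0 := by
  rw [← aeval_lineRestrict_complex]
  exact fun h => hz (hf.real_roots x z h)

/-- Every root w lies strictly below the real axis, so |z - w| ≥ Im z. This turns nonvanishing on
the upper half-plane into a bound that is closed under limits. -/
theorem norm_mul_im_pow_le {p : ℂ[X]} (hp : ∀ z : ℂ, 0 ≤ z.im → p.eval z ≠ 0) {z : ℂ}
    (hz : 0 ≤ z.im) : ‖p.leadingCoeff‖ * z.im ^ p.natDegree ≤ ‖p.eval z‖ := by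
  have hs : p.Splits := IsAlgClosed.splits p
  rw [hs.eval_eq_prod_roots, norm_mul, hs.natDegree_eq_card_roots]
  refine mul_le_mul_of_nonneg_left ?_ (norm_nonneg _)
  have hn : ‖(p.roots.map (z - ·)).prod‖ = (p.roots.map fun w => ‖z - w‖).prod :=
    (map_multiset_prod (normHom : ℂ →*₀ ℝ) _).trans (by rw [Multiset.map_map]; rfl)
  rw [hn, ← Multiset.prod_replicate, ← Multiset.map_const']
  refine Multiset.prod_map_le_prod_map₀ _ _ (fun _ _ => hz) fun w hw => ?_
  have hw' : w.im < 0 := by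
    by_contra! h
    exact hp w h (mem_roots'.1 hw).2
  refine le_trans ?_ (Complex.abs_im_le_norm _)
  rw [Complex.sub_im]
  exact le_trans (by linarith) (le_abs_self _)

/-- The base point of the deformation in `aeval_ne_zero_of_mem_rootCone`. -/
theorem aeval_ne_zero_of_mem_rootCone_of_base (hd : f.IsHomogeneous d) (hf : IsHyperbolic f e)
    {a : Fin n → ℝ} (ha : a ∈ rootCone f e) {α : ℝ} (hα : 0 < α) {t : ℂ} (ht : 0 ≤ t.im) :
    MvPolynomial.aeval (t • toComplex a + (α * Complex.I) • toComplex e) f ≠ 0 := by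
  rcases eq_or_ne t 0 with rfl | h0
  · rw [zero_smul, zero_add, aeval_smul_of_isHomogeneous hd, aeval_toComplex]
    exact mul_ne_zero (pow_ne_zero _ (by simp [hα.ne'])) (by exact_mod_cast hf.eval_ne_zero)
  · have : t • toComplex a + (α * Complex.I) • toComplex e =
        t • ((α * Complex.I / t) • toComplex e + toComplex a) := by
      rw [smul_add, smul_smul, mul_div_cancel₀ _ h0, add_comm]
    rw [this, aeval_smul_of_isHomogeneous hd]
    refine mul_ne_zero (pow_ne_zero _ h0) fun h => ?_
    set z := α * Complex.I / t with hz
    -- Re(iα/t) = α · Im t / |t|² ≥ 0. Hyperbolicity excludes nonreal z, and membership of a in the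
    -- root cone excludes real z ≥ 0.
    have hre : 0 ≤ z.re := by
      rw [hz, Complex.div_re]
      simp only [Complex.mul_re, Complex.mul_im, Complex.ofReal_re, Complex.ofReal_im,
        Complex.I_re, Complex.I_im]
      have := Complex.normSq_nonneg t
      simp only [mul_zero, zero_mul, sub_zero, zero_div, mul_one, zero_add, add_zero]
      positivity
    have him : z.im = 0 := by
      by_contra hne
      exact hf.aeval_ne_zero a hne h
    have hzr : z = (z.re : ℂ) := Complex.ext rfl (by simp [him])
    have hcast : z • toComplex e + toComplex a = toComplex (z.re • e + a) := by
      rw [hzr]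
      ext i
      simp [toComplex]
    rw [hcast, aeval_toComplex] at h
    exact ha z.re hre (by exact_mod_cast h)

/-- Gårding's theorem, in the form of the stability of `f(x + z e + t a)` for `a` in the
hyperbolicity cone. -/
theorem aeval_ne_zero_of_mem_rootCone (hd : f.IsHomogeneous d) (hf : IsHyperbolic f e)
    {a : Fin n → ℝ} (ha : a ∈ rootCone f e) (x : Fin n → ℝ) {α : ℝ} (hα : 0 < α) {t : ℂ}
    (ht : 0 ≤ t.im) :
    MvPolynomial.aeval (t • toComplex a + ((α * Complex.I) • toComplex e + toComplex x)) f ≠ 0 := by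
  have ha0 : MvPolynomial.aeval (toComplex a) f ≠ 0 := by
    rw [aeval_toComplex]
    have := ha 0 le_rfl
    rw [zero_smul, zero_add] at this
    exact_mod_cast this
  -- Deform x to 0 along sx: the set T of good parameters s is open, closed and contains 0, hence is
  -- all of ℝ.
  set b : ℝ → Fin n → ℂ := fun s => (α * Complex.I) • toComplex e + toComplex (s • x) with hb
  have hbc : Continuous b := by
    have := continuous_toComplex (n := n)
    fun_prop
  set T : Set ℝ := {s | ∀ z : ℂ, 0 ≤ z.im → MvPolynomial.aeval (z • toComplex a + b s) f ≠ 0}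
  have hc := continuous_aeval_complex f
  have hopen : IsOpen T := by
    -- The closed half-plane of z is compactified by homogeneous pairs (z, r). The points at
    -- infinity r = 0 give z ^ d · f(a), which is nonzero.
    set Q : Set (ℂ × ℝ) := Metric.sphere 0 1 ∩ {q | 0 ≤ q.1.im ∧ 0 ≤ q.2} with hQ
    have hQc : IsCompact Q := by
      refine (isCompact_sphere _ _).inter_right ?_
      exact (isClosed_le continuous_const (Complex.continuous_im.comp continuous_fst)).inter
        (isClosed_le continuous_const continuous_snd)
    have hTQ : T = {s | ∀ q ∈ Q, MvPolynomial.aeval (q.1 • toComplex a + (q.2 : ℂ) • b s) f ≠ 0} := by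
      ext s
      constructor
      · rintro hs ⟨z, r⟩ ⟨hq, hz, hr⟩
        simp only at hz hr ⊢
        rcases hr.eq_or_lt with rfl | hr
        · have hz0 : z ≠ 0 := by
            rintro rfl
            simp at hq
          rw [Complex.ofReal_zero, zero_smul, add_zero, aeval_smul_of_isHomogeneous hd]
          exact mul_ne_zero (pow_ne_zero _ hz0) ha0
        · have hr0 : (r : ℂ) ≠ 0 := by exact_mod_cast hr.ne'
          have : z • toComplex a + (r : ℂ) • b s = (r : ℂ) • ((z / r) • toComplex a + b s) := by
            rw [smul_add (r : ℂ) _ (b s), smul_smul, mul_div_cancel₀ _ hr0]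
          rw [this, aeval_smul_of_isHomogeneous hd]
          refine mul_ne_zero (pow_ne_zero _ hr0) (hs _ ?_)
          rw [Complex.div_ofReal_im]
          positivity
      · intro hs z hz h0
        have hne : 0 < ‖((z, 1) : ℂ × ℝ)‖ := norm_pos_iff.2 (by simp)
        set N := ‖((z, 1) : ℂ × ℝ)‖
        refine hs (N⁻¹ • (z, 1)) ⟨?_, ?_, ?_⟩ ?_
        · rw [mem_sphere_zero_iff_norm, norm_smul, norm_inv, Real.norm_of_nonneg hne.le]
          exact inv_mul_cancel₀ hne.ne'
        · simp only [Prod.smul_fst, Complex.smul_im, smul_eq_mul]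
          positivity
        · simp only [Prod.smul_snd, smul_eq_mul]
          positivity
        · have : (N⁻¹ • ((z, 1) : ℂ × ℝ)).1 • toComplex a + (((N⁻¹ • ((z, 1) : ℂ × ℝ)).2 : ℝ) : ℂ) • b s
              = ((N⁻¹ : ℝ) : ℂ) • (z • toComplex a + b s) := by
            ext i
            simp
            ring
          rw [this, aeval_smul_of_isHomogeneous hd, h0, mul_zero]
    rw [hTQ]
    exact isOpen_forall_ne_zero hQc
      (P := fun p : ℝ × ℂ × ℝ =>
        MvPolynomial.aeval (p.2.1 • toComplex a + (p.2.2 : ℂ) • b p.1) f)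
      (hc.comp (by fun_prop))
  have hclosed : IsClosed T := by
    -- The closed bound is vacuous on the real axis, but there hyperbolicity alone rules out zeros,
    -- since α > 0.
    have hTc : T = {s | ∀ z : ℂ, 0 ≤ z.im → ‖MvPolynomial.aeval (toComplex a) f‖ * z.im ^ d ≤
        ‖MvPolynomial.aeval (z • toComplex a + b s) f‖} := by
      ext s
      constructor
      · intro hs z hz
        have := norm_mul_im_pow_le (p := linePoly f (toComplex a) (b s))
          (fun w hw => by rw [eval_linePoly]; exact hs w hw) hz
        rwa [leadingCoeff_linePoly hd ha0, natDegree_linePoly hd ha0, eval_linePoly] at this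
      · intro hs z hz h0
        rcases hz.eq_or_lt with hz0 | hz0
        · have hzr : z = (z.re : ℂ) := Complex.ext rfl (by simp [← hz0])
          have hcast : z • toComplex a + b s =
              (α * Complex.I) • toComplex e + toComplex (z.re • a + s • x) := by
            rw [hzr]
            ext i
            simp [toComplex, hb]
            ring
          rw [hcast] at h0
          exact hf.aeval_ne_zero _ (by simp [hα.ne']) h0
        · have := hs z hz
          rw [h0, norm_zero] at this
          have h1 : 0 < ‖MvPolynomial.aeval (toComplex a) f‖ := norm_pos_iff.2 ha0
          have : 0 < ‖MvPolynomial.aeval (toComplex a) f‖ * z.im ^ d := by positivity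
          linarith
    rw [hTc]
    simp only [Set.ofPred_forall]
    refine isClosed_iInter fun z => isClosed_iInter fun _ => ?_
    exact isClosed_le continuous_const (hc.comp (by fun_prop)).norm
  have hmem : (0 : ℝ) ∈ T := by
    intro z hz
    have : b 0 = (α * Complex.I) • toComplex e := by
      ext i
      simp [hb, toComplex]
    rw [this]
    exact aeval_ne_zero_of_mem_rootCone_of_base hd hf ha hα hz
  have huniv : T = Set.univ := IsClopen.eq_univ ⟨hclosed, hopen⟩ ⟨0, hmem⟩
  have h1 : (1 : ℝ) ∈ T := huniv ▸ Set.mem_univ _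
  simpa [hb] using h1 t ht

/-! ### The anti-Herglotz property of D_a f / f -/

/-- The imaginary part of `G / F` is nonpositive on the upper half-plane. -/
def IsAntiHerglotz (G F : ℝ[X]) : Prop :=
  ∀ z : ℂ, 0 < z.im → (aeval z G * (starRingEnd ℂ) (aeval z F)).im ≤ 0

/-- p'(0)/p(0) is the sum of -1/w over the roots w, and Im(-1/w) = Im w / |w|² < 0. -/
theorem im_logDeriv_nonpos {p : ℂ[X]} (hp : ∀ z : ℂ, 0 ≤ z.im → p.eval z ≠ 0) :
    (p.derivative.eval 0 * (starRingEnd ℂ) (p.eval 0)).im ≤ 0 := by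
  have hs : p.Splits := IsAlgClosed.splits p
  have h0 : p.eval 0 ≠ 0 := hp 0 le_rfl
  have hsum := hs.eval_derivative_div_eval_of_ne_zero h0
  have him : (p.derivative.eval 0 / p.eval 0).im ≤ 0 := by
    rw [hsum, ← Complex.coe_imAddGroupHom, map_multiset_sum, Multiset.map_map]
    refine Multiset.sum_induction (· ≤ 0) _ (fun _ _ => add_nonpos) le_rfl fun y hy => ?_
    obtain ⟨w, hw, rfl⟩ := Multiset.mem_map.1 hy
    have hw' : w.im < 0 := by
      by_contra! h
      exact hp w h (mem_roots'.1 hw).2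
    simp only [Function.comp, Complex.coe_imAddGroupHom, zero_sub, one_div, Complex.inv_im,
      Complex.neg_im, neg_neg]
    exact div_nonpos_of_nonpos_of_nonneg hw'.le (Complex.normSq_nonneg _)
  have hmul : p.derivative.eval 0 * (starRingEnd ℂ) (p.eval 0) =
      (p.derivative.eval 0 / p.eval 0) * (Complex.normSq (p.eval 0) : ℂ) := by
    rw [← Complex.mul_conj, ← mul_assoc, div_mul_cancel₀ _ h0]
  rw [hmul, Complex.im_mul_ofReal]
  exact mul_nonpos_of_nonpos_of_nonneg him (Complex.normSq_nonneg _)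

/-- D_a f(ze + x) is the derivative at t = 0 of f(ta + ze + x). The real part of z is absorbed into
x, so stability applies with α = Im z. -/
theorem isAntiHerglotz_of_mem_rootCone (hd : f.IsHomogeneous d) (hf : IsHyperbolic f e)
    {a : Fin n → ℝ} (ha : a ∈ rootCone f e) (x : Fin n → ℝ) :
    IsAntiHerglotz (lineRestrict (dirDeriv a f) e x) (lineRestrict f e x) := by
  intro z hz
  have hsplit : z • toComplex e + toComplex x =
      (z.im * Complex.I) • toComplex e + toComplex (z.re • e + x) := by
    ext i
    simp only [toComplex, Pi.add_apply, Pi.smul_apply, smul_eq_mul, Complex.coe_algebraMap,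
      Complex.ofReal_add, Complex.ofReal_mul]
    conv_lhs => rw [← Complex.re_add_im z]
    ring
  have h := im_logDeriv_nonpos (p := linePoly f (toComplex a) (z • toComplex e + toComplex x))
    fun t ht => by
      rw [eval_linePoly, hsplit]
      exact aeval_ne_zero_of_mem_rootCone hd hf ha _ hz ht
  have hder := derivative_linePoly f a (z • toComplex e + toComplex x)
  change derivative (linePoly f (toComplex a) _) = linePoly _ (toComplex a) _ at hder
  rwa [hder, eval_linePoly, eval_linePoly, zero_smul, zero_add, ← aeval_lineRestrict_complex,
    ← aeval_lineRestrict_complex] at h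

theorem isAntiHerglotz_of_mem_closure (hd : f.IsHomogeneous d) (hf : IsHyperbolic f e)
    (hpos : 0 < MvPolynomial.eval e f) {a : Fin n → ℝ}
    (ha : a ∈ closure (hyperbolicityCone f e)) (x : Fin n → ℝ) :
    IsAntiHerglotz (lineRestrict (dirDeriv a f) e x) (lineRestrict f e x) := by
  rw [hyperbolicityCone_eq_rootCone hd hf hpos] at ha
  intro z hz
  have hlin : Continuous fun b : Fin n → ℝ => aeval z (lineRestrict (dirDeriv b f) e x) := by
    simp only [aeval_lineRestrict_complex, dirDeriv, map_sum, map_mul, MvPolynomial.algHom_C]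
    refine continuous_finsetSum _ fun i _ => ?_
    exact (Complex.continuous_ofReal.comp (continuous_apply i)).mul continuous_const
  have hcl : IsClosed {b : Fin n → ℝ | (aeval z (lineRestrict (dirDeriv b f) e x) *
      (starRingEnd ℂ) (aeval z (lineRestrict f e x))).im ≤ 0} :=
    isClosed_le (Complex.continuous_im.comp (hlin.mul continuous_const)) continuous_const
  exact closure_minimal (fun b hb => isAntiHerglotz_of_mem_rootCone hd hf hb x z hz) hcl ha

/-! ### Interlacing and counting functions -/

/-- The number of indices `i` with `α i ≤ x`. -/
noncomputable def countLe {m : ℕ} (α : Fin m → ℝ) (x : ℝ) : ℕ :=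
  ∑ i, if α i ≤ x then 1 else 0

theorem countLe_eq_card {m : ℕ} (α : Fin m → ℝ) (x : ℝ) :
    countLe α x = (Finset.univ.filter fun i => α i ≤ x).card := by
  simp [countLe]

theorem Monotone.lt_countLe {m : ℕ} {α : Fin m → ℝ} (hα : Monotone α) {i : Fin m} {x : ℝ}
    (h : α i ≤ x) : (i : ℕ) < countLe α x := by
  rw [countLe_eq_card, Nat.lt_iff_add_one_le, ← Fin.card_Iic]
  refine Finset.card_le_card fun j hj => ?_
  simp only [Finset.mem_filter, Finset.mem_univ, true_and]
  exact (hα (Finset.mem_Iic.1 hj)).trans h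

theorem Monotone.countLe_le {m : ℕ} {α : Fin m → ℝ} (hα : Monotone α) {i : Fin m} {x : ℝ}
    (h : x < α i) : countLe α x ≤ i := by
  rw [countLe_eq_card, ← Fin.card_Iio]
  refine Finset.card_le_card fun j hj => ?_
  simp only [Finset.mem_filter, Finset.mem_univ, true_and] at hj
  rw [Finset.mem_Iio]
  by_contra! hij
  exact absurd (hα hij) (not_le.2 (hj.trans_lt h))

theorem countLe_of_interlacing {m : ℕ} {α : Fin (m + 1) → ℝ} {β : Fin m → ℝ}
    (h : ∀ i : Fin m, α i.castSucc ≤ β i ∧ β i ≤ α i.succ) (x : ℝ) :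
    countLe β x ≤ countLe α x ∧ countLe α x ≤ countLe β x + 1 := by
  constructor
  · unfold countLe
    rw [Fin.sum_univ_castSucc]
    refine le_add_right (Finset.sum_le_sum fun i _ => ?_)
    have := (h i).1
    split_ifs <;> first | (exfalso; linarith) | simp
  · unfold countLe
    rw [Fin.sum_univ_succ, add_comm]
    refine add_le_add (Finset.sum_le_sum fun i _ => ?_) (by split_ifs <;> simp)
    have := (h i).2
    split_ifs <;> first | (exfalso; linarith) | simp

/-- Together with `countLe_of_interlacing`, this encodes interlacing by counting functions that
differ by 0 or 1. A common root adds the same amount to both counts, wherever it falls in the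
ordering. -/
theorem interlacing_of_countLe {m : ℕ} {α : Fin (m + 1) → ℝ} {β : Fin m → ℝ}
    (hα : Monotone α) (hβ : Monotone β)
    (h : ∀ x, countLe β x ≤ countLe α x ∧ countLe α x ≤ countLe β x + 1) (i : Fin m) :
    α i.castSucc ≤ β i ∧ β i ≤ α i.succ := by
  constructor
  · by_contra! hlt
    have h1 := Monotone.countLe_le hα hlt
    have h2 := Monotone.lt_countLe hβ (le_refl (β i))
    have h3 := (h (β i)).1
    rw [Fin.val_castSucc] at h1
    omega
  · by_contra! hlt
    have h1 := Monotone.countLe_le hβ hlt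
    have h2 := Monotone.lt_countLe hα (le_refl (α i.succ))
    have h3 := (h (α i.succ)).2
    rw [Fin.val_succ] at h2
    omega

/-- Multiplying both polynomials by a common linear factor preserves interlacing. -/
theorem Interlaces.X_sub_C_mul {q p : ℝ[X]} (h : Interlaces q p) (r : ℝ) :
    Interlaces ((X - C r) * q) ((X - C r) * p) := by
  obtain ⟨m, α, β, c, c', hc, hc', hα, hβ, rfl, rfl, hi⟩ := h
  have key : ∀ {k : ℕ} (γ : Fin k → ℝ), ∃ δ : Fin (k + 1) → ℝ, Monotone δ ∧
      (∏ i, (X - C (δ i)) = (X - C r) * ∏ i, (X - C (γ i))) ∧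
      ∀ x, countLe δ x = (if r ≤ x then 1 else 0) + countLe γ x := by
    intro k γ
    refine ⟨Fin.cons r γ ∘ Tuple.sort (Fin.cons r γ : Fin (k + 1) → ℝ),
      Tuple.monotone_sort _, ?_, fun x => ?_⟩
    · simp only [Function.comp]
      rw [Equiv.prod_comp (Tuple.sort (Fin.cons r γ : Fin (k + 1) → ℝ))
        fun i => X - C ((Fin.cons r γ : Fin (k + 1) → ℝ) i), Fin.prod_univ_succ]
      simp
    · simp only [countLe, Function.comp]
      rw [Equiv.sum_comp (Tuple.sort (Fin.cons r γ : Fin (k + 1) → ℝ))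
        fun i => if (Fin.cons r γ : Fin (k + 1) → ℝ) i ≤ x then 1 else 0, Fin.sum_univ_succ]
      simp
  obtain ⟨α', hα', hpα, hcα⟩ := key α
  obtain ⟨β', hβ', hpβ, hcβ⟩ := key β
  refine ⟨m + 1, α', β', c, c', hc, hc', hα', hβ', by rw [hpα]; ring, by rw [hpβ]; ring, ?_⟩
  refine interlacing_of_countLe hα' hβ' fun x => ?_
  have := countLe_of_interlacing hi x
  rw [hcα, hcβ]
  omega

/-! ### Anti-Herglotz pairs -/

theorem aeval_ofReal (F : ℝ[X]) (t : ℝ) : aeval (t : ℂ) F = ((F.eval t : ℝ) : ℂ) := by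
  rw [← Complex.coe_algebraMap, aeval_algebraMap_apply, coe_aeval_eq_eval]

theorem IsAntiHerglotz.of_X_sub_C_mul {G F : ℝ[X]} {r : ℝ}
    (h : IsAntiHerglotz ((X - C r) * G) ((X - C r) * F)) : IsAntiHerglotz G F := by
  intro z hz
  have h1 := h z hz
  have hne : z - (r : ℂ) ≠ 0 := by
    intro h0
    have := congrArg Complex.im h0
    simp at this
    linarith
  have hrw : aeval z ((X - C r) * G) * (starRingEnd ℂ) (aeval z ((X - C r) * F)) =
      (aeval z G * (starRingEnd ℂ) (aeval z F)) * (Complex.normSq (z - r) : ℂ) := by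
    rw [← Complex.mul_conj]
    simp
    ring
  rw [hrw, Complex.im_mul_ofReal] at h1
  exact nonpos_of_mul_nonpos_left h1 (Complex.normSq_pos.2 hne)

/-- The Wronskian of an anti-Herglotz pair is nonnegative on the real line. -/
theorem IsAntiHerglotz.wronskian_nonneg {G F : ℝ[X]} (h : IsAntiHerglotz G F) (t : ℝ) :
    0 ≤ F.derivative.eval t * G.eval t - F.eval t * G.derivative.eval t := by
  have hline : HasDerivAt (fun y : ℝ => (t : ℂ) + y * Complex.I) Complex.I 0 := by
    have := ((Complex.ofRealCLM.hasDerivAt (x := (0 : ℝ))).mul_const Complex.I).const_add (t : ℂ)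
    simpa using this
  have hcomp : ∀ P : ℝ[X], HasDerivAt (fun y : ℝ => aeval ((t : ℂ) + y * Complex.I) P)
      (((P.derivative.eval t : ℝ) : ℂ) * Complex.I) 0 := by
    intro P
    have h1 := P.hasDerivAt_aeval ((t : ℂ) + (0 : ℝ) * Complex.I)
    have h2 : HasDerivAt (fun y : ℝ => aeval ((t : ℂ) + y * Complex.I) P)
      (aeval ((t : ℂ) + (0 : ℝ) * Complex.I) P.derivative * Complex.I) 0 :=
      HasDerivAt.comp (h₂ := fun z : ℂ => aeval z P) (0 : ℝ) h1 hline
    rwa [Complex.ofReal_zero, zero_mul, add_zero, aeval_ofReal] at h2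
  have hprod := (hcomp G).mul ((Complex.conjCLE.toContinuousLinearMap.hasFDerivAt).comp_hasDerivAt
    (0 : ℝ) (hcomp F))
  have him := Complex.imCLM.hasFDerivAt.comp_hasDerivAt (0 : ℝ) hprod
  -- φ vanishes at 0 and is nonpositive for y > 0, so φ'(0) ≤ 0; this derivative is minus the
  -- Wronskian at t.
  set φ : ℝ → ℝ := fun y => (aeval ((t : ℂ) + y * Complex.I) G *
    (starRingEnd ℂ) (aeval ((t : ℂ) + y * Complex.I) F)).im with hφ
  have hder : HasDerivAt φ
      (G.derivative.eval t * F.eval t - G.eval t * F.derivative.eval t) 0 := by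
    refine HasDerivAt.congr_deriv him ?_
    simp [aeval_ofReal]
    ring
  have h0 : φ 0 = 0 := by simp [hφ, aeval_ofReal]
  have hslope := hder.tendsto_slope.mono_left (nhdsGT_le_nhdsNE 0)
  have hle := le_of_tendsto hslope (b := 0) (eventually_mem_nhdsWithin.mono fun y hy => by
    have hy' : 0 < y := hy
    rw [slope_def_field, h0, sub_zero, sub_zero]
    refine div_nonpos_of_nonpos_of_nonneg (h _ ?_) hy'.le
    simpa using hy')
  linarith

/-- An anti-Herglotz pair without a common zero at `r` has at most a simple pole there. -/
theorem IsAntiHerglotz.rootMultiplicity_le_one {G F : ℝ[X]} (h : IsAntiHerglotz G F)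
    (hF : F ≠ 0) {r : ℝ} (hG : G.eval r ≠ 0) : F.rootMultiplicity r ≤ 1 := by
  by_contra! hm
  set m := F.rootMultiplicity r with hmdef
  obtain ⟨H, hFH, hH⟩ := exists_eq_pow_rootMultiplicity_mul_and_not_dvd F hF r
  rw [← hmdef] at hFH
  have hHr : H.eval r ≠ 0 := fun h0 => hH (dvd_iff_isRoot.2 h0)
  have hm0 : (0 : ℝ) < m := by exact_mod_cast (by omega : 0 < m)
  -- Approach r along the ray of angle θ and divide by s ^ m: in the limit Im(G(r) H(r) e^{-imθ}) ≤
  -- 0.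
  have key : ∀ θ : ℝ, 0 < θ → θ < Real.pi → 0 ≤ G.eval r * H.eval r * Real.sin (m * θ) := by
    intro θ h1 h2
    set w : ℝ → ℂ := fun s => r + s * Complex.exp (θ * Complex.I) with hw
    have hle : ∀ s : ℝ, 0 < s → (aeval (w s) G * (starRingEnd ℂ)
        (Complex.exp (θ * Complex.I) ^ m * aeval (w s) H)).im ≤ 0 := by
      intro s hs
      have him : 0 < (w s).im := by
        simp only [hw, Complex.add_im, Complex.ofReal_im, zero_add, Complex.im_ofReal_mul,
          Complex.exp_ofReal_mul_I_im]
        exact mul_pos hs (Real.sin_pos_of_pos_of_lt_pi h1 h2)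
      have h3 := h _ him
      have hrw : aeval (w s) G * (starRingEnd ℂ) (aeval (w s) F) =
          (aeval (w s) G * (starRingEnd ℂ)
            (Complex.exp (θ * Complex.I) ^ m * aeval (w s) H)) * ((s ^ m : ℝ) : ℂ) := by
        have hws : w s - r = s * Complex.exp (θ * Complex.I) := by simp [hw]
        rw [hFH]
        simp only [map_mul, map_pow, map_sub, aeval_X, aeval_C, Complex.coe_algebraMap]
        rw [← Complex.conj_ofReal r, ← map_sub, Complex.conj_ofReal, hws]
        simp only [map_mul, Complex.conj_ofReal, mul_pow, Complex.ofReal_pow]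
        ring
      rw [hrw, Complex.im_mul_ofReal] at h3
      exact nonpos_of_mul_nonpos_left h3 (pow_pos hs m)
    have hcont : Continuous fun s : ℝ => (aeval (w s) G * (starRingEnd ℂ)
        (Complex.exp (θ * Complex.I) ^ m * aeval (w s) H)).im := by
      have hwc : Continuous w := by fun_prop
      have hc : ∀ P : ℝ[X], Continuous fun s : ℝ => aeval (w s) P :=
        fun P => P.continuous_aeval.comp hwc
      exact Complex.continuous_im.comp ((hc G).mul
        (Complex.continuous_conj.comp (continuous_const.mul (hc H))))
    have hlim := (hcont.tendsto 0).mono_left (nhdsWithin_le_nhds (s := Set.Ioi 0))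
    have h4 := le_of_tendsto hlim (eventually_mem_nhdsWithin.mono fun s hs => hle s hs)
    have hexp : Complex.exp (θ * Complex.I) ^ m = Complex.exp (((m * θ : ℝ) : ℂ) * Complex.I) := by
      rw [← Complex.exp_nat_mul]
      congr 1
      push_cast
      ring
    have hw0 : w 0 = (r : ℂ) := by simp [hw]
    rw [hw0, aeval_ofReal, aeval_ofReal, hexp, map_mul, Complex.conj_ofReal, mul_left_comm,
      ← Complex.ofReal_mul, Complex.im_mul_ofReal, Complex.conj_im,
      Complex.exp_ofReal_mul_I_im] at h4
    linarith
  have hπ := Real.pi_pos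
  have hm2 : (2 : ℝ) ≤ m := by exact_mod_cast hm
  -- For m ≥ 2 the angles π/(2m) and 3π/(2m) both lie in (0, π), while sin(mθ) is 1 at the first and
  -- -1 at the second.
  have k1 := key (Real.pi / 2 / m) (by positivity) (by
    rw [div_lt_iff₀ hm0]; nlinarith)
  have k2 := key ((Real.pi / 2 + Real.pi) / m) (by positivity) (by
    rw [div_lt_iff₀ hm0]; nlinarith)
  rw [mul_div_cancel₀ _ hm0.ne'] at k1 k2
  rw [Real.sin_add_pi, Real.sin_pi_div_two] at k2
  rw [Real.sin_pi_div_two] at k1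
  exact mul_ne_zero hG hHr (by linarith)

/-- A split polynomial with simple roots is given by a strictly increasing list of roots. -/
theorem exists_strictMono_roots {F : ℝ[X]} (hF : F.Splits) (hnd : F.roots.Nodup) {m : ℕ}
    (hm : F.natDegree = m) : ∃ α : Fin m → ℝ, StrictMono α ∧
      F = C F.leadingCoeff * Lagrange.nodal Finset.univ α := by
  have hcard : F.roots.toFinset.card = m := by
    rw [Multiset.toFinset_card_of_nodup hnd, ← hF.natDegree_eq_card_roots, hm]
  refine ⟨F.roots.toFinset.orderEmbOfFin hcard,
    (F.roots.toFinset.orderEmbOfFin hcard).strictMono, ?_⟩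
  conv_lhs => rw [hF.eq_prod_roots]
  congr 1
  have h1 : (F.roots.map (X - C ·)).prod = ∏ x ∈ F.roots.toFinset, (X - C x) := by
    rw [Finset.prod, Multiset.toFinset_val, hnd.dedup]
  rw [h1, Lagrange.nodal]
  have himg : Finset.univ.image (F.roots.toFinset.orderEmbOfFin hcard) = F.roots.toFinset :=
    Finset.image_orderEmbOfFin_univ _ hcard
  conv_lhs => rw [← himg]
  rw [Finset.prod_image fun _ _ _ _ h => (F.roots.toFinset.orderEmbOfFin hcard).injective h]

/-- The derivative of a polynomial with simple roots changes sign between consecutive roots. -/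
theorem eval_derivative_nodal_mul_neg {m : ℕ} {α : Fin (m + 1) → ℝ} (hα : StrictMono α)
    (i : Fin m) :
    (Lagrange.nodal Finset.univ α).derivative.eval (α i.castSucc) *
      (Lagrange.nodal Finset.univ α).derivative.eval (α i.succ) < 0 := by
  classical
  have hlt : α i.castSucc < α i.succ := hα Fin.castSucc_lt_succ
  have hne : i.castSucc ≠ i.succ := Fin.castSucc_lt_succ.ne
  rw [Lagrange.eval_nodal_derivative_eval_node_eq (Finset.mem_univ _),
    Lagrange.eval_nodal_derivative_eval_node_eq (Finset.mem_univ _),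
    Lagrange.eval_nodal, Lagrange.eval_nodal,
    ← Finset.mul_prod_erase (Finset.univ.erase i.castSucc) _
      (Finset.mem_erase.2 ⟨hne.symm, Finset.mem_univ _⟩),
    ← Finset.mul_prod_erase (Finset.univ.erase i.succ) _
      (Finset.mem_erase.2 ⟨hne, Finset.mem_univ _⟩), Finset.erase_right_comm]
  set S := (Finset.univ.erase i.succ).erase i.castSucc with hS
  -- No root lies between two consecutive ones, so every remaining factor has the same sign at both.
  -- Only the two factors involving both roots have opposite signs.
  have hpos : 0 < (∏ j ∈ S, (α i.castSucc - α j)) * ∏ j ∈ S, (α i.succ - α j) := by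
    rw [← Finset.prod_mul_distrib]
    refine Finset.prod_pos fun j hj => ?_
    simp only [hS, Finset.mem_erase, Finset.mem_univ, and_true] at hj
    rcases lt_or_gt_of_ne hj.1 with h | h
    · exact mul_pos (sub_pos.2 (hα h)) (sub_pos.2 (hα (h.trans Fin.castSucc_lt_succ)))
    · have h' : i.succ < j := lt_of_le_of_ne (Fin.castSucc_lt_iff_succ_le.1 h) hj.2.symm
      exact mul_pos_of_neg_of_neg (sub_neg.2 (hα h)) (sub_neg.2 (hα h'))
  nlinarith [mul_pos hpos (mul_pos (sub_pos.2 hlt) (sub_pos.2 hlt))]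

/-- The roots of F are simple, and at each of them the Wronskian reduces to F'G ≥ 0. As F'
alternates in sign, so does G, which gives a root of G in each gap; the degree bound leaves room for
no others. -/
theorem IsAntiHerglotz.interlaces_of_no_common_root {G F : ℝ[X]} (h : IsAntiHerglotz G F)
    (hF : F.Splits) (hF0 : F ≠ 0) (hG0 : G ≠ 0) (hdeg : G.degree < F.degree)
    (hcop : ∀ r, F.eval r = 0 → G.eval r ≠ 0) : Interlaces G F := by
  have hnd : F.roots.Nodup := Multiset.nodup_iff_count_le_one.2 fun r => by
    rw [count_roots]
    by_cases hr : F.eval r = 0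
    · exact h.rootMultiplicity_le_one hF0 (hcop r hr)
    · rw [rootMultiplicity_eq_zero hr]
      exact Nat.zero_le _
  have hlt : G.natDegree < F.natDegree := natDegree_lt_natDegree hG0 hdeg
  obtain ⟨m, hm⟩ : ∃ m, F.natDegree = m + 1 := ⟨F.natDegree - 1, by omega⟩
  obtain ⟨α, hα, hFα⟩ := exists_strictMono_roots hF hnd hm
  set c := F.leadingCoeff with hc
  have hc0 : c ≠ 0 := leadingCoeff_ne_zero.2 hF0
  set N := Lagrange.nodal Finset.univ α with hN
  have hNα : ∀ i, N.eval (α i) = 0 := fun i => Lagrange.eval_nodal_at_node (Finset.mem_univ i)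
  have hFα0 : ∀ i, F.eval (α i) = 0 := fun i => by rw [hFα, eval_mul, hNα, mul_zero]
  have hW : ∀ i, 0 ≤ c * N.derivative.eval (α i) * G.eval (α i) := fun i => by
    have := h.wronskian_nonneg (α i)
    rw [hFα0, zero_mul, sub_zero] at this
    rw [hFα] at this
    simpa using this
  have hGne : ∀ i, G.eval (α i) ≠ 0 := fun i => hcop _ (hFα0 i)
  have hroot : ∀ i : Fin m, ∃ b, α i.castSucc < b ∧ b < α i.succ ∧ G.eval b = 0 := by
    intro i
    have hs := eval_derivative_nodal_mul_neg hα i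
    have h12 := mul_nonneg (hW i.castSucc) (hW i.succ)
    have hGs : G.eval (α i.castSucc) * G.eval (α i.succ) < 0 := by
      refine lt_of_le_of_ne ?_ (mul_ne_zero (hGne _) (hGne _))
      by_contra! hpos
      have hc2 : 0 < c ^ 2 := by positivity
      nlinarith [mul_pos hpos (mul_pos hc2 (neg_pos.2 hs))]
    have hab := (hα (Fin.castSucc_lt_succ (i := i))).le
    have hcont : ContinuousOn (fun x => G.eval x) (Set.Icc (α i.castSucc) (α i.succ)) :=
      G.continuous.continuousOn
    rcases mul_neg_iff.1 hGs with ⟨h1, h2⟩ | ⟨h1, h2⟩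
    · obtain ⟨b, hb, hb0⟩ := intermediate_value_Ioo' hab hcont ⟨h2, h1⟩
      exact ⟨b, hb.1, hb.2, hb0⟩
    · obtain ⟨b, hb, hb0⟩ := intermediate_value_Ioo hab hcont ⟨h1, h2⟩
      exact ⟨b, hb.1, hb.2, hb0⟩
  choose β hβ1 hβ2 hβ0 using hroot
  have hβ : StrictMono β := fun i j hij =>
    (hβ2 i).trans_le ((hα.monotone (Fin.succ_le_castSucc_iff.2 hij)).trans (hβ1 j).le)
  have hdvd : Lagrange.nodal Finset.univ β ∣ G := by
    refine Finset.prod_dvd_of_coprime (fun i _ j _ hij => ?_) fun i _ => dvd_iff_isRoot.2 (hβ0 i)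
    exact isCoprime_X_sub_C_of_isUnit_sub (sub_ne_zero.2 (hβ.injective.ne hij)).isUnit
  obtain ⟨k, hk⟩ := hdvd
  have hk0 : k ≠ 0 := by
    rintro rfl
    simp [hG0] at hk
  have hkdeg : k.natDegree = 0 := by
    have h1 : G.natDegree = m + k.natDegree := by
      rw [hk, (Lagrange.nodal_monic).natDegree_mul' hk0, Lagrange.natDegree_nodal]
      simp
    omega
  obtain ⟨c', hc'⟩ := natDegree_eq_zero.1 hkdeg
  refine ⟨m, α, β, c, c', hc0, ?_, hα.monotone, hβ.monotone, hFα, ?_,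
    fun i => ⟨(hβ1 i).le, (hβ2 i).le⟩⟩
  · rintro rfl
    simp at hc'
    exact hk0 hc'.symm
  · rw [hk, ← hc', mul_comm]
    rfl

/-- Common real roots are divided out one at a time: a common factor multiplies G · conj F by a
positive number off the real axis, and restoring it preserves interlacing. -/
theorem IsAntiHerglotz.eq_zero_or_interlaces {G F : ℝ[X]} (h : IsAntiHerglotz G F)
    (hF : F.Splits) (hF0 : F ≠ 0) (hdeg : G.degree < F.degree) : G = 0 ∨ Interlaces G F := by
  induction hk : F.natDegree using Nat.strong_induction_on generalizing F G with
  | _ k ih =>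
  rcases eq_or_ne G 0 with hG0 | hG0
  · exact Or.inl hG0
  by_cases hcop : ∀ r, F.eval r = 0 → G.eval r ≠ 0
  · exact Or.inr (h.interlaces_of_no_common_root hF hF0 hG0 hdeg hcop)
  push Not at hcop
  obtain ⟨r, hFr, hGr⟩ := hcop
  obtain ⟨F₁, rfl⟩ := dvd_iff_isRoot.2 hFr
  obtain ⟨G₁, rfl⟩ := dvd_iff_isRoot.2 hGr
  have hF1 : F₁ ≠ 0 := right_ne_zero_of_mul hF0
  have hdeg1 : G₁.degree < F₁.degree := by
    simp only [degree_mul, degree_X_sub_C] at hdeg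
    exact lt_of_add_lt_add_left hdeg
  have hnat : F₁.natDegree < k := by
    rw [← hk, natDegree_mul (X_sub_C_ne_zero r) hF1, natDegree_X_sub_C]
    omega
  rcases ih _ hnat h.of_X_sub_C_mul (splits_X_sub_C_mul_iff.1 hF) hF1 hdeg1 rfl with h0 | hI
  · exact Or.inl (by rw [h0, mul_zero])
  · exact Or.inr (hI.X_sub_C_mul r)

/-! ### Linearity, degree and nonnegativity of Δ -/

theorem dirDeriv_smul (a : Fin n → ℝ) (c : ℝ) (p : MvPolynomial (Fin n) ℝ) :
    dirDeriv a (c • p) = c • dirDeriv a p := by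
  rw [MvPolynomial.smul_eq_C_mul, dirDeriv_mul, dirDeriv_C, zero_mul, zero_add,
    MvPolynomial.smul_eq_C_mul]

theorem dirDeriv_zero (a : Fin n → ℝ) : dirDeriv a (0 : MvPolynomial (Fin n) ℝ) = 0 := by
  simp [dirDeriv]

theorem dirDeriv_add_left (f : MvPolynomial (Fin n) ℝ) (a b : Fin n → ℝ) :
    dirDeriv (a + b) f = dirDeriv a f + dirDeriv b f :=
  (dirDerivLinear f).map_add a b

theorem dirDeriv_smul_left (f : MvPolynomial (Fin n) ℝ) (c : ℝ) (a : Fin n → ℝ) :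
    dirDeriv (c • a) f = c • dirDeriv a f :=
  (dirDerivLinear f).map_smul c a

theorem isLinearMap_delta (f : MvPolynomial (Fin n) ℝ) (e : Fin n → ℝ) :
    IsLinearMap ℝ fun a => delta f e a where
  map_add a b := by
    simp only [delta, dirDeriv_add_left, dirDeriv_add]
    ring
  map_smul c a := by
    simp only [delta, dirDeriv_smul_left, dirDeriv_smul, mul_smul_comm, smul_sub]

theorem dirDeriv_eq_zero_of_isHomogeneous_zero (hd : f.IsHomogeneous 0) (a : Fin n → ℝ) :
    dirDeriv a f = 0 := by
  rw [MvPolynomial.totalDegree_eq_zero_iff_eq_C.1 (Nat.le_zero.1 hd.totalDegree_le), dirDeriv_C]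

theorem isHomogeneous_delta (hd : f.IsHomogeneous d) (e a : Fin n → ℝ) :
    (delta f e a).IsHomogeneous (2 * d - 2) := by
  have h1 := isHomogeneous_dirDeriv hd e
  have h2 := isHomogeneous_dirDeriv hd a
  have h3 := isHomogeneous_dirDeriv h2 e
  have h12 := h1.mul h2
  rw [show d - 1 + (d - 1) = 2 * d - 2 by omega] at h12
  refine h12.sub ?_
  -- For d ≤ 1 the truncated degrees do not add up, but then D_a f is constant and the second term
  -- vanishes.
  rcases le_or_gt d 1 with h | h
  · rw [show d - 1 = 0 by omega] at h2
    rw [dirDeriv_eq_zero_of_isHomogeneous_zero h2, mul_zero]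
    exact MvPolynomial.isHomogeneous_zero _ _ _
  · have := hd.mul h3
    rwa [show d + (d - 1 - 1) = 2 * d - 2 by omega] at this

theorem mem_span_pderiv_iff {g : MvPolynomial (Fin n) ℝ} :
    g ∈ Submodule.span ℝ (Set.range fun i : Fin n => MvPolynomial.pderiv i f) ↔
      ∃ a, dirDeriv a f = g := by
  simp only [Submodule.mem_span_range_iff_exists_fun, dirDeriv, MvPolynomial.smul_eq_C_mul]

theorem eval_delta_line (f : MvPolynomial (Fin n) ℝ) (e a x : Fin n → ℝ) (t : ℝ) :
    MvPolynomial.eval (t • e + x) (delta f e a) =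
      (lineRestrict f e x).derivative.eval t * (lineRestrict (dirDeriv a f) e x).eval t -
      (lineRestrict f e x).eval t * (lineRestrict (dirDeriv a f) e x).derivative.eval t := by
  rw [derivative_lineRestrict, derivative_lineRestrict]
  simp only [eval_lineRestrict, delta, map_sub, map_mul]

theorem eval_delta_nonneg_of_mem_closure (hd : f.IsHomogeneous d) (hf : IsHyperbolic f e)
    (hpos : 0 < MvPolynomial.eval e f) {a : Fin n → ℝ}
    (ha : a ∈ closure (hyperbolicityCone f e)) (x : Fin n → ℝ) :
    0 ≤ MvPolynomial.eval x (delta f e a) := by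
  have := (isAntiHerglotz_of_mem_closure hd hf hpos ha x).wronskian_nonneg 0
  rwa [← eval_delta_line, zero_smul, zero_add] at this

/-! ### Converses: excluding positive zeros on the line through a -/

/-- Euler's identity along the line `t e + a`. -/
theorem lineRestrict_dirDeriv_self (hd : f.IsHomogeneous d) (e a : Fin n → ℝ) :
    lineRestrict (dirDeriv a f) e a =
      C (d : ℝ) * lineRestrict f e a - X * derivative (lineRestrict f e a) := by
  rw [derivative_lineRestrict]
  refine Polynomial.funext fun t => ?_
  have h := euler_dirDeriv hd (t • e + a)
  rw [dirDeriv_add_left, dirDeriv_smul_left, map_add, MvPolynomial.smul_eval] at h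
  simp only [eval_sub, eval_mul, eval_C, eval_X, eval_lineRestrict]
  linarith

/-- The Wronskian is FF' + t(FF'' - F'²). At a root r > 0 of multiplicity j + 1, with cofactor H,
dividing by (t - r) ^ (2j) leaves the value -r(j + 1)H(r)² < 0 at r. -/
theorem exists_wronskian_euler_neg {F : ℝ[X]} (hF : F ≠ 0) (k : ℝ) {r : ℝ} (hr : 0 < r)
    (hFr : F.eval r = 0) :
    ∃ t, F.derivative.eval t * (C k * F - X * derivative F).eval t -
      F.eval t * (C k * F - X * derivative F).derivative.eval t < 0 := by
  by_contra! hW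
  obtain ⟨H, hFH, hH⟩ := exists_eq_pow_rootMultiplicity_mul_and_not_dvd F hF r
  have hHr : H.eval r ≠ 0 := fun h0 => hH (dvd_iff_isRoot.2 h0)
  obtain ⟨j, hj⟩ : ∃ j, F.rootMultiplicity r = j + 1 :=
    ⟨F.rootMultiplicity r - 1, by have := (rootMultiplicity_pos hF).2 hFr; omega⟩
  rw [hj] at hFH
  set u : ℝ[X] := X - C r with hu
  have hdu : derivative u = 1 := by simp [hu]
  set P : ℝ[X] := C ((j : ℝ) + 1) * H + u * derivative H with hP
  have hF1 : derivative F = u ^ j * P := by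
    rw [hFH, derivative_mul, derivative_pow, hdu, hP]
    simp
    ring
  -- The extra factor u avoids the exponent j - 1, which would truncate at j = 0.
  have hF2 : u * derivative (derivative F) = u ^ j * (C (j : ℝ) * P + u * derivative P) := by
    rw [hF1, derivative_mul, derivative_pow, hdu]
    rcases j with _ | i
    · simp
    · simp [pow_succ]
      ring
  set B : ℝ[X] := -X * P ^ 2 + X * H * (C (j : ℝ) * P + u * derivative P) + u * H * P with hB
  have hWB : derivative F * (C k * F - X * derivative F) -
      F * derivative (C k * F - X * derivative F) = (u ^ j) ^ 2 * B := by
    have h1 : F * derivative (derivative F) =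
        (u ^ j) ^ 2 * (H * (C (j : ℝ) * P + u * derivative P)) := by
      linear_combination derivative (derivative F) * hFH + u ^ j * H * hF2
    have h2 : F * derivative F = (u ^ j) ^ 2 * (u * H * P) := by
      rw [hF1, hFH]
      ring
    have h3 : derivative F ^ 2 = (u ^ j) ^ 2 * P ^ 2 := by rw [hF1]; ring
    simp only [derivative_sub, derivative_mul, derivative_C, derivative_X]
    linear_combination (-X) * h3 + h2 + X * h1
  have hBnn : ∀ t, t ≠ r → 0 ≤ B.eval t := by
    intro t ht
    have h1 := hW t
    rw [← eval_mul, ← eval_mul, ← eval_sub, hWB, eval_mul, eval_pow] at h1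
    refine nonneg_of_mul_nonneg_right h1 ?_
    have : (u ^ j).eval t ≠ 0 := by
      simp [hu, sub_ne_zero.2 ht]
    positivity
  have hBr := ge_of_tendsto ((B.continuous.tendsto r).mono_left (nhdsWithin_le_nhds (s := {r}ᶜ)))
    (eventually_mem_nhdsWithin.mono fun t ht => hBnn t ht)
  have hBval : B.eval r = -(r * (j + 1) * H.eval r ^ 2) := by
    simp [hB, hP, hu]
    ring
  have : 0 < r * (j + 1) * H.eval r ^ 2 := by positivity
  linarith

theorem lineRestrict_ne_zero (hd : f.IsHomogeneous d) (he : MvPolynomial.eval e f ≠ 0)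
    (a : Fin n → ℝ) : lineRestrict f e a ≠ 0 := by
  rw [← leadingCoeff_ne_zero, leadingCoeff_lineRestrict hd he]
  exact he

theorem mem_closure_of_eval_delta_nonneg (hd : f.IsHomogeneous d) (hf : IsHyperbolic f e)
    (hpos : 0 < MvPolynomial.eval e f) {a : Fin n → ℝ}
    (h : ∀ x, 0 ≤ MvPolynomial.eval x (delta f e a)) :
    a ∈ closure (hyperbolicityCone f e) := by
  rw [mem_closure_hyperbolicityCone_iff hd hf hpos]
  intro r hr h0
  obtain ⟨t, ht⟩ := exists_wronskian_euler_neg (lineRestrict_ne_zero hd hf.eval_ne_zero a) d hr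
    (by rwa [eval_lineRestrict])
  rw [← lineRestrict_dirDeriv_self hd, ← eval_delta_line] at ht
  exact (h _).not_gt ht

theorem leadingCoeff_C_mul_prod {ι : Type*} (s : Finset ι) (c : ℝ) (α : ι → ℝ) :
    (C c * ∏ i ∈ s, (X - C (α i))).leadingCoeff = c := by
  rw [leadingCoeff_mul, leadingCoeff_C, (monic_prod_X_sub_C α s).leadingCoeff, mul_one]

theorem natDegree_C_mul_prod {ι : Type*} (s : Finset ι) {c : ℝ} (hc : c ≠ 0) (α : ι → ℝ) :
    (C c * ∏ i ∈ s, (X - C (α i))).natDegree = s.card := by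
  rw [natDegree_C_mul hc, natDegree_prod_of_monic _ _ fun i _ => monic_X_sub_C _]
  simp

theorem Interlaces.natDegree_eq {q p : ℝ[X]} (h : Interlaces q p) :
    p.natDegree = q.natDegree + 1 := by
  obtain ⟨m, α, β, c, c', hc, hc', -, -, rfl, rfl, -⟩ := h
  rw [natDegree_C_mul_prod _ hc, natDegree_C_mul_prod _ hc']
  simp

/-- If `k F - t F'` interlaces `F` and both leading coefficients are positive, then `F` has no
positive zeros. -/
theorem Interlaces.eval_ne_zero {F : ℝ[X]} {k : ℕ} (hk : F.natDegree = k)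
    (h : Interlaces (C (k : ℝ) * F - X * derivative F) F) (hF : 0 < F.leadingCoeff)
    (hG : 0 < (C (k : ℝ) * F - X * derivative F).leadingCoeff) {r : ℝ} (hr : 0 < r) :
    F.eval r ≠ 0 := by
  intro hFr
  set G := C (k : ℝ) * F - X * derivative F with hGdef
  obtain ⟨m, α, β, c, c', hc, hc', hα, hβ, hFα, hGβ, hi⟩ := h
  have hcF : c = F.leadingCoeff := by rw [hFα, leadingCoeff_C_mul_prod]
  have hcG : c' = G.leadingCoeff := by rw [hGβ, leadingCoeff_C_mul_prod]
  have hFe : ∀ t, F.eval t = c * ∏ i, (t - α i) := fun t => by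
    rw [hFα]
    simp [eval_prod]
  have hGe : ∀ t, G.eval t = c' * ∏ i, (t - β i) := fun t => by
    rw [hGβ]
    simp [eval_prod]
  have hkpos : (0 : ℝ) < k := by
    rw [← hk, hFα, natDegree_C_mul_prod _ hc]
    simp
    positivity
  set s := α (Fin.last m) with hs
  have hle : ∀ x, F.eval x = 0 → x ≤ s := by
    intro x hx
    rw [hFe] at hx
    obtain ⟨i, -, hi0⟩ := Finset.prod_eq_zero_iff.1 ((mul_eq_zero.1 hx).resolve_left hc)
    rw [sub_eq_zero.1 hi0]
    exact hα (Fin.le_last i)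
  have hs0 : 0 < s := hr.trans_le (hle r hFr)
  -- Chosen beyond the largest root s so that t/(t - s) = k + 1. The root s alone gives F'/F ≥ 1/(t
  -- - s), so tF' ≥ (k + 1)F > kF at t, against G(t) > 0.
  set t := s + s / k with ht
  have hst : s < t := by
    have : 0 < s / k := by positivity
    linarith
  have hFt : 0 < F.eval t := by
    rw [hFe]
    refine mul_pos (hcF ▸ hF) (Finset.prod_pos fun i _ => sub_pos.2 ?_)
    exact (hα (Fin.le_last i)).trans_lt hst
  have hGt : 0 < G.eval t := by
    rw [hGe]
    refine mul_pos (hcG ▸ hG) (Finset.prod_pos fun i _ => sub_pos.2 ?_)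
    exact ((hi i).2.trans (hα (Fin.le_last _))).trans_lt hst
  have hsplit : F.Splits := by
    rw [hFα]
    exact (Splits.prod fun i _ => Splits.X_sub_C _).C_mul c
  have hsum := hsplit.eval_derivative_div_eval_of_ne_zero hFt.ne'
  have hF0 : F ≠ 0 := leadingCoeff_ne_zero.1 hF.ne'
  have hsroot : s ∈ F.roots := by
    rw [mem_roots hF0, IsRoot, hFe, Finset.prod_eq_zero (Finset.mem_univ (Fin.last m)) (sub_self _),
      mul_zero]
  have hone : 1 / (t - s) ≤ F.derivative.eval t / F.eval t := by
    rw [hsum]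
    refine Multiset.single_le_sum (fun y hy => ?_) _ (Multiset.mem_map_of_mem _ hsroot)
    obtain ⟨x, hx, rfl⟩ := Multiset.mem_map.1 hy
    have := hle x (mem_roots'.1 hx).2
    exact one_div_nonneg.2 (by linarith)
  rw [le_div_iff₀ hFt, ht, add_sub_cancel_left, one_div_div] at hone
  have hGt' : 0 < k * F.eval t - t * F.derivative.eval t := by
    simpa [hGdef] using hGt
  have h1 := mul_le_mul_of_nonneg_left hone (hs0.trans hst).le
  have h2 : t * (k / s * F.eval t) = (k + 1) * F.eval t := by
    rw [ht]
    field_simp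
  linarith

theorem totalDegree_eq (hd : f.IsHomogeneous d) (he : MvPolynomial.eval e f ≠ 0) :
    f.totalDegree = d :=
  hd.totalDegree fun h => he (by simp [h])

theorem mem_closure_of_dirDeriv_mem_interlacerCone (hd : f.IsHomogeneous d)
    (hf : IsHyperbolic f e) (hpos : 0 < MvPolynomial.eval e f) {a : Fin n → ℝ}
    (h : dirDeriv a f ∈ interlacerCone f e) : a ∈ closure (hyperbolicityCone f e) := by
  rcases h with h | ⟨⟨hg, hI⟩, hge⟩
  · refine mem_closure_of_eval_delta_nonneg hd hf hpos fun x => ?_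
    rw [delta, h, dirDeriv_zero]
    simp
  · rw [mem_closure_hyperbolicityCone_iff hd hf hpos]
    intro r hr
    have hlG := leadingCoeff_lineRestrict hg hge.ne' a
    have hIa := hI a
    rw [lineRestrict_dirDeriv_self hd] at hIa hlG
    rw [← eval_lineRestrict]
    refine hIa.eval_ne_zero (natDegree_lineRestrict hd hf.eval_ne_zero a) ?_ ?_ hr
    · rwa [leadingCoeff_lineRestrict hd hf.eval_ne_zero]
    · rwa [hlG]

/-! ### From the closed cone to interlacers -/

theorem eval_self_delta (hd : f.IsHomogeneous (d + 1)) (e a : Fin n → ℝ) :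
    MvPolynomial.eval e (delta f e a) =
      MvPolynomial.eval e f * MvPolynomial.eval e (dirDeriv a f) := by
  have h1 := euler_dirDeriv hd e
  have h2 := euler_dirDeriv (isHomogeneous_dirDeriv hd a) e
  rw [Nat.add_sub_cancel] at h2
  rw [delta, map_sub, map_mul, map_mul, h1, h2]
  push_cast
  ring

/-- On each line the restriction of D_a f is zero or interlaces. A nonzero D_a f is nonzero on some
line, where interlacing forces full degree; the top coefficient D_a f(e), common to all lines, is
then nonzero, so no restriction vanishes. Its sign comes from Δ(e) = f(e) · D_a f(e) ≥ 0. -/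
theorem dirDeriv_mem_interlacerCone_of_mem_closure (hd : f.IsHomogeneous d)
    (hf : IsHyperbolic f e) (hpos : 0 < MvPolynomial.eval e f) {a : Fin n → ℝ}
    (ha : a ∈ closure (hyperbolicityCone f e)) : dirDeriv a f ∈ interlacerCone f e := by
  by_cases h0 : dirDeriv a f = 0
  · exact Or.inl h0
  obtain _ | k := d
  · exact absurd (dirDeriv_eq_zero_of_isHomogeneous_zero hd a) h0
  have hg : (dirDeriv a f).IsHomogeneous k := isHomogeneous_dirDeriv hd a
  have he := hf.eval_ne_zero
  have hor : ∀ x, lineRestrict (dirDeriv a f) e x = 0 ∨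
      Interlaces (lineRestrict (dirDeriv a f) e x) (lineRestrict f e x) := by
    intro x
    refine (isAntiHerglotz_of_mem_closure hd hf hpos ha x).eq_zero_or_interlaces (hf.splits x)
      (lineRestrict_ne_zero hd he x) (degree_lt_degree ?_)
    rw [natDegree_lineRestrict hd he]
    exact Nat.lt_succ_of_le (natDegree_linePoly_le hg e x)
  have hcoeff : ∀ x, (lineRestrict (dirDeriv a f) e x).coeff k =
      MvPolynomial.eval e (dirDeriv a f) := fun x => by
    rw [lineRestrict_eq_linePoly, coeff_linePoly hg, MvPolynomial.aeval_eq_eval]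
  have hne : MvPolynomial.eval e (dirDeriv a f) ≠ 0 := by
    obtain ⟨x, hx⟩ : ∃ x, MvPolynomial.eval x (dirDeriv a f) ≠ 0 := by
      by_contra! hall
      exact h0 (MvPolynomial.funext fun x => by rw [hall, map_zero])
    have hGx : lineRestrict (dirDeriv a f) e x ≠ 0 := by
      intro hz
      have := eval_lineRestrict (dirDeriv a f) e x 0
      rw [hz, eval_zero, zero_smul, zero_add] at this
      exact hx this.symm
    have hdeg := ((hor x).resolve_left hGx).natDegree_eq
    rw [natDegree_lineRestrict hd he, add_left_inj] at hdeg
    rw [← hcoeff x, hdeg]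
    exact leadingCoeff_ne_zero.2 hGx
  have hge : 0 < MvPolynomial.eval e (dirDeriv a f) := by
    have := eval_delta_nonneg_of_mem_closure hd hf hpos ha e
    rw [eval_self_delta hd] at this
    exact lt_of_le_of_ne (nonneg_of_mul_nonneg_right this hpos) hne.symm
  refine Or.inr ⟨⟨?_, fun x => (hor x).resolve_left fun hz => hne ?_⟩, hge⟩
  · rwa [totalDegree_eq hd he]
  · rw [← hcoeff x, hz, coeff_zero]

end Hyperbolicity

theorem theorem3p1 (n d : ℕ) (f : MvPolynomial (Fin n) ℝ) (e : Fin n → ℝ)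
    (hdeg : f.IsHomogeneous d) (hsq : Squarefree f)
    (hhyp : Hyperbolicity.IsHyperbolic f e) (hpos : 0 < MvPolynomial.eval e f) :
    -- the slice of `Int(f, e)` by the span of the partial derivatives of `f`
    (Hyperbolicity.interlacerCone f e ∩
        (Submodule.span ℝ (Set.range fun i : Fin n => MvPolynomial.pderiv i f) :
          Set (MvPolynomial (Fin n) ℝ)) =
      (fun a => Hyperbolicity.dirDeriv a f) '' closure (Hyperbolicity.hyperbolicityCone f e)) ∧
    (closure (Hyperbolicity.hyperbolicityCone f e) =
      {a | Hyperbolicity.dirDeriv a f ∈ Hyperbolicity.interlacerCone f e}) ∧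
    (closure (Hyperbolicity.hyperbolicityCone f e) =
      {a | ∀ x : Fin n → ℝ, 0 ≤ MvPolynomial.eval x (Hyperbolicity.delta f e a)}) ∧
    -- this is a linear section of the cone of nonnegative forms of degree `2 d - 2`
    IsLinearMap ℝ (fun a => Hyperbolicity.delta f e a) ∧
    (∀ a, (Hyperbolicity.delta f e a).IsHomogeneous (2 * d - 2)) ∧
    ((fun a => Hyperbolicity.delta f e a) '' closure (Hyperbolicity.hyperbolicityCone f e) =
      Set.range (fun a => Hyperbolicity.delta f e a) ∩
        Hyperbolicity.nonnegForms n (2 * d - 2)) := by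
  have hdel : closure (Hyperbolicity.hyperbolicityCone f e) =
      {a | ∀ x : Fin n → ℝ, 0 ≤ MvPolynomial.eval x (Hyperbolicity.delta f e a)} :=
    Set.ext fun _ => ⟨Hyperbolicity.eval_delta_nonneg_of_mem_closure hdeg hhyp hpos,
      Hyperbolicity.mem_closure_of_eval_delta_nonneg hdeg hhyp hpos⟩
  have hint : closure (Hyperbolicity.hyperbolicityCone f e) =
      {a | Hyperbolicity.dirDeriv a f ∈ Hyperbolicity.interlacerCone f e} :=
    Set.ext fun _ => ⟨Hyperbolicity.dirDeriv_mem_interlacerCone_of_mem_closure hdeg hhyp hpos,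
      Hyperbolicity.mem_closure_of_dirDeriv_mem_interlacerCone hdeg hhyp hpos⟩
  refine ⟨?_, hint, hdel, Hyperbolicity.isLinearMap_delta f e,
    Hyperbolicity.isHomogeneous_delta hdeg e, ?_⟩
  · rw [hint]
    ext g
    constructor
    · rintro ⟨hg, hspan⟩
      obtain ⟨a, rfl⟩ := Hyperbolicity.mem_span_pderiv_iff.1 hspan
      exact ⟨a, hg, rfl⟩
    · rintro ⟨a, ha, rfl⟩
      exact ⟨ha, Hyperbolicity.mem_span_pderiv_iff.2 ⟨a, rfl⟩⟩
  · rw [hdel]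
    ext g
    constructor
    · rintro ⟨a, ha, rfl⟩
      exact ⟨⟨a, rfl⟩, Hyperbolicity.isHomogeneous_delta hdeg e a, ha⟩
    · rintro ⟨⟨a, rfl⟩, -, ha⟩
      exact ⟨a, ha, rfl⟩
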